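/- Let $L,H,d>0$, $\beta>0$, $\tau,\alpha\ge 0$, $D:=(-L,L)$, $\Omega_1:=D\times(-H-d,-H)$, $\sigma_2>0$, and let $\sigma_1\in C^2(\overline{\Omega}_1)$ satisfy $\min_{\overline\Omega_1}\sigma_1>0$. Let $h_1:\bar D\times[-H-d,-H]\times[-H,\infty)\to[0,\infty)$ and $h_2:\bar D\times[-H,\infty)\times[-H,\infty)\to[0,\infty)$ be $C^2$-smooth functions of $(x,z,w)$ with $$h_1(x,-H,w)=h_2(x,-H,w),\qquad \sigma_1(x,-H)\,\partial_z h_1(x,-H,w)=\sigma_2\,\partial_z h_2(x,-H,w),\qquad (x,w)\in D\times[-H,\infty).$$ Let $H^2_D(D):=\{v\in H^2(D): v(\pm L)=\partial_x v(\pm L)=0\}$ and $\bar S_0:=\{v\in H^2_D(D): v\ge -H\text{ in }D\}$. For $u\in\bar S_0$ put $\mathcal C(u):=\{x\in D: u(x)=-H\}$ (the coincidence set), $\Omega_2(u):=\{(x,z): x\in D,\ -H<z<u(x)\}$, $\Omega(u):=\{(x,z): x\in D,\ -H-d<z<u(x)\}$, let $\sigma:=\sigma_1$ in $\Omega_1$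 and $\sigma:=\sigma_2$ in $D\times(-H,\infty)$, and let $h_u(x,z):=h_1(x,z,u(x))$ for $z\le -H$ and $h_u(x,z):=h_2(x,z,u(x))$ for $z>-H$. Let $\psi_u\in h_u+H^1_0(\Omega(u))$ be the variational solution of $\mathrm{div}(\sigma\nabla\psi_u)=0$ in $\Omega(u)$, $\psi_u=h_u$ on $\partial\Omega(u)$, let $\psi_{u,1},\psi_{u,2}$ be its restrictions to $\Omega_1$ and $\Omega_2(u)$, and let the electrostatic force be, for $x\in D$, $$g(u)(x):=\mathfrak g(u)(x)-\tfrac{\sigma_2}{2}\Big[(\partial_x h_2)^2+(\partial_z h_2+\partial_w h_2)^2\Big](x,u(x),u(x))+\sigma_1(x,-H-d)\,\partial_w h_1(x,-H-d,u(x))\,\partial_z\psi_{u,1}(x,-H-d),$$ where $$\mathfrak g(u)(x):=\tfrac{\sigma_2}{2}\big(1+(\partial_x u(x))^2\big)\Big[\partial_z\psi_{u,2}(x,u(x))-(\partial_z h_2+\partial_w h_2)(x,u(x),u(x))\Big]^2\quad\text{if }x\in D\setminus\mathcal C(u),$$ $$\mathfrak g(u)(x):=\tfrac{\sigma_2}{2}\Big[\tfrac{\sigma_1(x,-H)}{\sigma_2}\,\partial_z\psi_{u,1}(x,-H)-(\partial_z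 h_2+\partial_w h_2)(x,-H,-H)\Big]^2\quad\text{if }x\in\mathcal C(u),$$ the values of $\partial_z\psi_{u,1}$ and $\partial_z\psi_{u,2}$ at boundary points being understood as traces. Assume that the ground plate is held at potential $0$ and the elastic plate at a constant potential $V>0$, that is, $$h_1(x,-H-d,w)=0,\qquad h_2(x,w,w)=V,\qquad (x,w)\in\bar D\times[-H,\infty).$$ Let $u\in\bar S_0$ be a weak solution of the obstacle problem $\beta\partial_x^4u-(\tau+\alpha\|\partial_xu\|_{L_2(D)}^2)\partial_x^2u+\partial\mathbb I_{\bar S_0}(u)\ni -g(u)$ in $D$, that is, for all $w\in\bar S_0$, $$\int_D\Big\{\beta\,\partial_x^2u\,\partial_x^2(w-u)+\big[\tau+\alpha\|\partial_xu\|_{L_2(D)}^2\big]\partial_xu\,\partial_x(w-u)\Big\}\,dx\ \ge\ -\int_D g(u)(w-u)\,dx.$$ Then the coincidence set $\mathcal C(u)$ is either empty or an interval (possibly reduced to a point). -/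

import Mathlib

open MeasureTheory Set Filter Topology
open scoped ContDiff ENNReal

noncomputable section

/-! Weak derivatives and Sobolev spaces on open sets -/

section Sobolev

variable {E : Type*} [NormedAddCommGroup E] [NormedSpace ℝ E]

/-- `φ ∈ C_c^∞(U)`. -/
structure IsTestFun (U : Set E) (φ : E → ℝ) : Prop where
  smooth : ContDiff ℝ ∞ φ
  compact : HasCompactSupport φ
  supp : tsupport φ ⊆ U

variable [MeasureSpace E]

/-- On the open set `U`, the function `g` is the weak derivative of `f` in direction `v`. -/
structure IsWeakDeriv (U : Set E) (v : E) (f g : E → ℝ) : Prop where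
  locInt : LocallyIntegrableOn f U
  locInt' : LocallyIntegrableOn g U
  byParts : ∀ φ : E → ℝ, IsTestFun U φ →
    ∫ x in U, f x * fderiv ℝ φ x v = - ∫ x in U, g x * φ x

/-- The weak derivative of `f` on `U` in direction `v`. It is unique up to null subsets of `U`
whenever it exists; one representative is chosen. -/
def weakDeriv (U : Set E) (v : E) (f : E → ℝ) : E → ℝ :=
  Classical.epsilon fun g => IsWeakDeriv U v f g

/-- `f ∈ H¹(U)`. -/
structure MemH1 (U : Set E) (f : E → ℝ) : Prop where
  memL2 : MemLp f 2 (volume.restrict U)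
  weak : ∀ v : E, ∃ g : E → ℝ, IsWeakDeriv U v f g ∧ MemLp g 2 (volume.restrict U)

/-- `f ∈ H¹₀(U)`, the closure of `C_c^∞(U)` in `H¹(U)`. -/
structure MemH10 (U : Set E) (f : E → ℝ) : Prop where
  memH1 : MemH1 U f
  approx : ∃ φ : ℕ → E → ℝ, (∀ n, IsTestFun U (φ n)) ∧
    Tendsto (fun n => eLpNorm (fun x => φ n x - f x) 2 (volume.restrict U)) atTop (𝓝 0) ∧
    ∀ v : E, Tendsto (fun n => eLpNorm (fun x => fderiv ℝ (φ n) x v - weakDeriv U v f x) 2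
      (volume.restrict U)) atTop (𝓝 0)

/-- Trace from within `U` of a Sobolev function `f` at the boundary point `p`: the limit of the
means of `f` over `U ∩ B(p, r)` as `r → 0`. Where the boundary of `U` is locally a Lipschitz
graph, this is the usual trace at almost every boundary point, and it does not change when `f`
is modified on a null set. -/
def traceAt (U : Set E) (f : E → ℝ) (p : E) : ℝ :=
  limUnder (𝓝[>] (0 : ℝ)) fun r => ⨍ q in U ∩ Metric.ball p r, f q

end Sobolev

/-- `u ∈ H²(D)` with `u(±L) = ∂ₓu(±L) = 0`, where `D = (-L, L)`. Elements of `H²(D)` are identified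
with their representative in `C¹([-L, L])`, so that `∂ₓu` is the classical derivative; `∂ₓu` then
has a weak derivative in `L₂(D)`. Values of `u` outside `[-L, L]` are irrelevant. -/
structure MemH2D (L : ℝ) (u : ℝ → ℝ) : Prop where
  contDiffOn : ContDiffOn ℝ 1 u (Icc (-L) L)
  memH1_deriv : MemH1 (Ioo (-L) L) (deriv u)
  left : u (-L) = 0
  right : u L = 0
  deriv_left : derivWithin u (Icc (-L) L) (-L) = 0
  deriv_right : derivWithin u (Icc (-L) L) L = 0

/-- `∂ₓ²u` on `D = (-L, L)`, for `u ∈ H²(D)`. -/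
def secondDeriv (L : ℝ) (u : ℝ → ℝ) : ℝ → ℝ := weakDeriv (Ioo (-L) L) (1 : ℝ) (deriv u)

/-- The data of the device: half-length `L` of the plates, height `H` of the plate at rest above
the insulating layer, thickness `d` of that layer, the mechanical parameters `β, τ, α`, the
permittivities `σ₁ (x, z)` of the layer and `σ₂` of the free space, and the functions
`h₁ (x, z, w)`, `h₂ (x, z, w)` which give the boundary values of the potential. -/
structure Device where
  L : ℝ
  H : ℝ
  d : ℝ
  β : ℝ
  τ : ℝ
  α : ℝ
  σ₁ : ℝ × ℝ → ℝ
  σ₂ : ℝ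
  h₁ : ℝ × ℝ × ℝ → ℝ
  h₂ : ℝ × ℝ × ℝ → ℝ

namespace Device

variable (P : Device)

/-- `D = (-L, L)`. -/
def D : Set ℝ := Ioo (-P.L) P.L

/-- The insulating layer `Ω₁ = D × (-H-d, -H)`. -/
def Ω₁ : Set (ℝ × ℝ) := P.D ×ˢ Ioo (-P.H - P.d) (-P.H)

/-- The closure of `Ω₁`. -/
def clΩ₁ : Set (ℝ × ℝ) := Icc (-P.L) P.L ×ˢ Icc (-P.H - P.d) (-P.H)

/-- The free space `Ω₂(u)` between layer and plate. -/
def Ω₂ (u : ℝ → ℝ) : Set (ℝ × ℝ) := {q | q.1 ∈ P.D ∧ -P.H < q.2 ∧ q.2 < u q.1}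

/-- `Ω(u)`, the whole region between the two plates. -/
def Ω (u : ℝ → ℝ) : Set (ℝ × ℝ) := {q | q.1 ∈ P.D ∧ -P.H - P.d < q.2 ∧ q.2 < u q.1}

/-- The domain `[-L, L] × [-H-d, -H] × [-H, ∞)` of `h₁`. -/
def dom₁ : Set (ℝ × ℝ × ℝ) :=
  Icc (-P.L) P.L ×ˢ (Icc (-P.H - P.d) (-P.H) ×ˢ Ici (-P.H))

/-- The domain `[-L, L] × [-H, ∞) × [-H, ∞)` of `h₂`. -/
def dom₂ : Set (ℝ × ℝ × ℝ) :=
  Icc (-P.L) P.L ×ˢ (Ici (-P.H) ×ˢ Ici (-P.H))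

/-! Partial derivatives of `h₁`, `h₂`, up to the boundary of their domains. -/

/-- `∂_z h₁`. -/
def dzh₁ (p : ℝ × ℝ × ℝ) : ℝ := fderivWithin ℝ P.h₁ P.dom₁ p (0, 1, 0)

/-- `∂_w h₁`. -/
def dwh₁ (p : ℝ × ℝ × ℝ) : ℝ := fderivWithin ℝ P.h₁ P.dom₁ p (0, 0, 1)

/-- `∂ₓ h₂`. -/
def dxh₂ (p : ℝ × ℝ × ℝ) : ℝ := fderivWithin ℝ P.h₂ P.dom₂ p (1, 0, 0)

/-- `∂_z h₂`. -/
def dzh₂ (p : ℝ × ℝ × ℝ) : ℝ := fderivWithin ℝ P.h₂ P.dom₂ p (0, 1, 0)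

/-- `∂_w h₂`. -/
def dwh₂ (p : ℝ × ℝ × ℝ) : ℝ := fderivWithin ℝ P.h₂ P.dom₂ p (0, 0, 1)

/-- Standing assumptions on the data: signs of the parameters, `C²`-smoothness and positivity of
the permittivity, `C²`-smoothness and non-negativity of `h₁, h₂`, and compatibility of `h₁, h₂` at
the interface `z = -H`. -/
structure Admissible : Prop where
  L_pos : 0 < P.L
  H_pos : 0 < P.H
  d_pos : 0 < P.d
  β_pos : 0 < P.β
  τ_nonneg : 0 ≤ P.τ
  α_nonneg : 0 ≤ P.α
  σ₁_smooth : ContDiffOn ℝ 2 P.σ₁ P.clΩ₁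
  σ₁_pos : ∀ q ∈ P.clΩ₁, 0 < P.σ₁ q
  σ₂_pos : 0 < P.σ₂
  h₁_smooth : ContDiffOn ℝ 2 P.h₁ P.dom₁
  h₁_nonneg : ∀ p ∈ P.dom₁, 0 ≤ P.h₁ p
  h₂_smooth : ContDiffOn ℝ 2 P.h₂ P.dom₂
  h₂_nonneg : ∀ p ∈ P.dom₂, 0 ≤ P.h₂ p
  h_match : ∀ x ∈ P.D, ∀ w, -P.H ≤ w → P.h₁ (x, -P.H, w) = P.h₂ (x, -P.H, w)
  flux_match : ∀ x ∈ P.D, ∀ w, -P.H ≤ w →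
    P.σ₁ (x, -P.H) * P.dzh₁ (x, -P.H, w) = P.σ₂ * P.dzh₂ (x, -P.H, w)

/-- The closed convex set `S̄₀ = {v ∈ H²_D(D) : v ≥ -H in D}`. -/
def S₀ : Set (ℝ → ℝ) := {v | MemH2D P.L v ∧ ∀ x ∈ P.D, -P.H ≤ v x}

/-- The coincidence set `C(u) = {x ∈ D : u(x) = -H}`. -/
def coincidenceSet (u : ℝ → ℝ) : Set ℝ := {x | x ∈ P.D ∧ u x = -P.H}

/-- The permittivity `σ`: equal to `σ₁` in the layer and to `σ₂` above it. -/
def σ (q : ℝ × ℝ) : ℝ := if q.2 < -P.H then P.σ₁ q else P.σ₂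

/-- `h_u (x, z) = h (x, z, u(x))`. -/
def hu (u : ℝ → ℝ) (q : ℝ × ℝ) : ℝ :=
  if q.2 ≤ -P.H then P.h₁ (q.1, q.2, u q.1) else P.h₂ (q.1, q.2, u q.1)

/-- `ψ` is the electrostatic potential `ψ_u`, that is, the variational solution in
`h_u + H¹₀(Ω(u))` of the transmission problem `div(σ∇ψ) = 0` in `Ω(u)`, `ψ = h_u` on `∂Ω(u)`,
with continuity of `ψ` and of `σ ∂_z ψ` across the interface. -/
structure IsPotential (u : ℝ → ℝ) (ψ : ℝ × ℝ → ℝ) : Prop where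
  memH1 : MemH1 (P.Ω u) ψ
  boundary : MemH10 (P.Ω u) fun q => ψ q - P.hu u q
  weak : ∀ φ : ℝ × ℝ → ℝ, IsTestFun (P.Ω u) φ →
    ∫ q in P.Ω u, P.σ q *
      (weakDeriv (P.Ω u) (1, 0) ψ q * fderiv ℝ φ q (1, 0)
        + weakDeriv (P.Ω u) (0, 1) ψ q * fderiv ℝ φ q (0, 1)) = 0

/-- Trace of `∂_z ψ_{u,1}` from within `Ω₁`. -/
def dzψ₁ (ψ : ℝ × ℝ → ℝ) (p : ℝ × ℝ) : ℝ :=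
  traceAt P.Ω₁ (weakDeriv P.Ω₁ (0, 1) ψ) p

/-- Trace of `∂_z ψ_{u,2}` from within `Ω₂(u)`. -/
def dzψ₂ (u : ℝ → ℝ) (ψ : ℝ × ℝ → ℝ) (p : ℝ × ℝ) : ℝ :=
  traceAt (P.Ω₂ u) (weakDeriv (P.Ω₂ u) (0, 1) ψ) p

open Classical in
/-- The quadratic part `𝔤(u)` of the electrostatic force; it has different expressions off and on
the coincidence set. -/
def forceMain (u : ℝ → ℝ) (ψ : ℝ × ℝ → ℝ) (x : ℝ) : ℝ :=
  if x ∈ P.coincidenceSet u then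
    P.σ₂ / 2 * (P.σ₁ (x, -P.H) / P.σ₂ * P.dzψ₁ ψ (x, -P.H)
      - P.dzh₂ (x, -P.H, u x) - P.dwh₂ (x, -P.H, u x)) ^ 2
  else
    P.σ₂ / 2 * (1 + (deriv u x) ^ 2) * (P.dzψ₂ u ψ (x, u x)
      - P.dzh₂ (x, u x, u x) - P.dwh₂ (x, u x, u x)) ^ 2

/-- The electrostatic force `g(u)`, computed from the potential `ψ = ψ_u`. -/
def force (u : ℝ → ℝ) (ψ : ℝ × ℝ → ℝ) (x : ℝ) : ℝ :=
  P.forceMain u ψ x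
    - P.σ₂ / 2 * ((P.dxh₂ (x, u x, u x)) ^ 2
        + (P.dzh₂ (x, u x, u x) + P.dwh₂ (x, u x, u x)) ^ 2)
    + P.σ₁ (x, -P.H - P.d) * P.dwh₁ (x, -P.H - P.d, u x) * P.dzψ₁ ψ (x, -P.H - P.d)

/-- `u ∈ S̄₀` is a weak solution of the obstacle problem
`β∂ₓ⁴u - (τ + α‖∂ₓu‖²)∂ₓ²u + ∂𝕀_{S̄₀}(u) ∋ -g(u)` in `D`, where `g(u)` is computed from the solution
`ψ_u` of the transmission problem. No integrability of `g(u)` is required here. -/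
def IsWeakSolution (u : ℝ → ℝ) : Prop :=
  u ∈ P.S₀ ∧ ∃ ψ : ℝ × ℝ → ℝ, P.IsPotential u ψ ∧ ∀ w ∈ P.S₀,
    - ∫ x in P.D, P.force u ψ x * (w x - u x) ≤
      ∫ x in P.D, (P.β * secondDeriv P.L u x * (secondDeriv P.L w x - secondDeriv P.L u x)
        + (P.τ + P.α * ∫ y in P.D, (deriv u y) ^ 2) * deriv u x * (deriv w x - deriv u x))

end Device

end

/-! The plates carry constant potentials, so the derivatives of `h₁` and `h₂` tangential to the
boundary conditions vanish. Only the square `forceMain` survives in the force, which is therefore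
non-negative whatever the potential `ψ` is (`force_nonneg`). Neither the transmission problem nor
the regularity of `ψ` enters.

Let `a ≤ b` lie in the coincidence set. Both are interior minima of `u`, so `u' = 0` there, and
replacing `u` by `-H` on `[a, b]` gives an admissible competitor `w ≤ u` (`flatten_mem_S₀`). Tested
with `w`, the variational inequality has a non-negative force side, while its elastic side equals
`-∫_{[a,b]} (β u''² + T u'²)` with `T = τ + α‖u'‖² ≥ 0`. Hence `u'' = 0` a.e. on `[a, b]`; as `u'(a)
= 0` and `u(a) = -H`, `u` equals `-H` on the whole of `[a, b]`.

The analytic work is to show that the competitor stays in `H²_D` and that its second derivative is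
`u''` cut off on `[a, b]`. This rests on reading a continuous function with an integrable weak
derivative as a primitive (`IsWeakDeriv.sub_eq_integral`). -/

/-! ### Weak derivatives on an interval -/

/-- Integration by parts against a smooth function, for a function given as a primitive. -/
theorem integral_mul_deriv_of_eq_primitive {f g φ : ℝ → ℝ} {c d : ℝ} (hcd : c ≤ d)
    (hg : IntervalIntegrable g volume c d)
    (hf : ∀ x ∈ Icc c d, f x = f c + ∫ t in c..x, g t) (hφ : ContDiff ℝ 1 φ) :
    ∫ x in c..d, f x * deriv φ x = f d * φ d - f c * φ c - ∫ x in c..d, g x * φ x := by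
  set F : ℝ → ℝ := fun x => f c + ∫ t in c..x, g t with hF
  -- `F` has derivative `g` only almost everywhere, so integration by parts is done for absolutely
  -- continuous functions.
  have hprim : AbsolutelyContinuousOnInterval (fun x => ∫ t in c..x, g t) c d :=
    hg.absolutelyContinuousOnInterval_intervalIntegral (by simp)
  have hconst : AbsolutelyContinuousOnInterval (fun _ : ℝ => f c) c d :=
    (contDiffOn_const (n := 1)).absolutelyContinuousOnInterval
  have hFac : AbsolutelyContinuousOnInterval F c d := hconst.add hprim
  have hφac : AbsolutelyContinuousOnInterval φ c d :=
    hφ.contDiffOn.absolutelyContinuousOnInterval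
  have hderiv : ∀ᵐ x, x ∈ uIcc c d → deriv F x = g x := by
    filter_upwards [hg.ae_hasDerivAt_integral] with x hx hxm
    exact ((hx hxm c (by simp)).const_add (f c)).deriv
  have key := hFac.integral_mul_deriv_eq_deriv_mul hφac
  have h1 : ∫ x in c..d, F x * deriv φ x = ∫ x in c..d, f x * deriv φ x := by
    refine intervalIntegral.integral_congr fun x hx => ?_
    rw [uIcc_of_le hcd] at hx
    simp only [hF, hf x hx]
  have h2 : ∫ x in c..d, deriv F x * φ x = ∫ x in c..d, g x * φ x := by
    refine intervalIntegral.integral_congr_ae ?_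
    filter_upwards [hderiv] with x hx hxm
    rw [hx (uIoc_subset_uIcc hxm)]
  rw [h1, h2] at key
  rw [key, hf d (right_mem_Icc.2 hcd)]
  simp [hF]

theorem IsTestFun.continuous_deriv {U : Set ℝ} {φ : ℝ → ℝ} (hφ : IsTestFun U φ) :
    Continuous (deriv φ) :=
  hφ.smooth.continuous_deriv (by simp)

theorem IsTestFun.integrableOn_mul {U : Set ℝ} {f φ : ℝ → ℝ} (hφ : IsTestFun U φ)
    (hf : IntegrableOn f U) : IntegrableOn (fun x => f x * φ x) U :=
  (Integrable.locallyIntegrable hf).integrable_smul_right_of_hasCompactSupport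
    hφ.smooth.continuous hφ.compact

theorem IsTestFun.integrableOn_mul_deriv {U : Set ℝ} {f φ : ℝ → ℝ} (hφ : IsTestFun U φ)
    (hf : IntegrableOn f U) : IntegrableOn (fun x => f x * deriv φ x) U :=
  (Integrable.locallyIntegrable hf).integrable_smul_right_of_hasCompactSupport
    hφ.continuous_deriv hφ.compact.deriv

theorem IsTestFun.integrableOn_mul_of_locallyIntegrableOn {U : Set ℝ} {f φ : ℝ → ℝ}
    (hφ : IsTestFun U φ) (hf : LocallyIntegrableOn f U) :
    Integrable (fun x => f x * φ x) := by
  have hK : IsCompact (tsupport φ) := hφ.compact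
  have h1 : IntegrableOn (fun x => f x * φ x) (tsupport φ) :=
    (hf.integrableOn_compact_subset hφ.supp hK).mul_continuousOn
      hφ.smooth.continuous.continuousOn hK
  refine (integrableOn_iff_integrable_of_support_subset ?_).1 h1
  intro x hx
  refine subset_tsupport φ ?_
  intro h0
  exact hx (by simp [h0])

theorem IsTestFun.setIntegral_mul {U : Set ℝ} {φ : ℝ → ℝ} (hφ : IsTestFun U φ) (f : ℝ → ℝ) :
    ∫ x in U, f x * φ x = ∫ x, f x * φ x := by
  refine setIntegral_eq_integral_of_forall_compl_eq_zero fun x hx => ?_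
  rw [image_eq_zero_of_notMem_tsupport fun h => hx (hφ.supp h), mul_zero]

/-- Weak derivatives are unique almost everywhere. -/
theorem IsWeakDeriv.ae_eq {U : Set ℝ} (hU : IsOpen U) {v : ℝ} {f g g' : ℝ → ℝ}
    (h : IsWeakDeriv U v f g) (h' : IsWeakDeriv U v f g') : g =ᵐ[volume.restrict U] g' := by
  have key := hU.ae_eq_zero_of_integral_contDiff_smul_eq_zero (μ := volume)
    (h.locInt'.sub h'.locInt') ?_
  · rw [EventuallyEq, ae_restrict_iff' hU.measurableSet]
    filter_upwards [key] with x hx hxU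
    exact sub_eq_zero.1 (hx hxU)
  · intro φ h1 h2 h3
    have hφ : IsTestFun U φ := ⟨h1, h2, h3⟩
    have e := (h.byParts φ hφ).symm.trans (h'.byParts φ hφ)
    rw [hφ.setIntegral_mul, hφ.setIntegral_mul, neg_inj] at e
    have : ∀ x, φ x • (g - g') x = g x * φ x - g' x * φ x := fun x => by
      simp only [smul_eq_mul, Pi.sub_apply]; ring
    simp_rw [this]
    rw [integral_sub (hφ.integrableOn_mul_of_locallyIntegrableOn h.locInt')
      (hφ.integrableOn_mul_of_locallyIntegrableOn h'.locInt'), e, sub_self]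

/-- `MemH1` asks for a weak derivative in every direction; on the line all are multiples of the one
in direction `1`. -/
theorem IsWeakDeriv.direction {U : Set ℝ} {f g : ℝ → ℝ} (h : IsWeakDeriv U 1 f g) (v : ℝ) :
    IsWeakDeriv U v f (fun x => v * g x) where
  locInt := h.locInt
  locInt' := h.locInt'.smul v
  byParts φ hφ := by
    have e : ∀ x, fderiv ℝ φ x v = v * fderiv ℝ φ x 1 := fun x => by
      conv_lhs => rw [← mul_one v, ← smul_eq_mul, map_smul, smul_eq_mul]
    have := h.byParts φ hφ
    simp_rw [e, mul_left_comm _ v, mul_assoc, integral_const_mul, this]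
    ring

theorem isWeakDeriv_weakDeriv {U : Set ℝ} {v : ℝ} {f g : ℝ → ℝ} (h : IsWeakDeriv U v f g) :
    IsWeakDeriv U v f (weakDeriv U v f) :=
  Classical.epsilon_spec (p := fun g => IsWeakDeriv U v f g) ⟨g, h⟩

theorem setIntegral_Ioo_eq_intervalIntegral {c d : ℝ} (hcd : c ≤ d) (f : ℝ → ℝ) :
    ∫ x in Ioo c d, f x = ∫ x in c..d, f x := by
  rw [intervalIntegral.integral_of_le hcd, integral_Ioc_eq_integral_Ioo]

/-- A test function on an interval with vanishing integral is the derivative of a test function. -/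
theorem IsTestFun.exists_deriv_eq {c d : ℝ} {χ : ℝ → ℝ} (hχ : IsTestFun (Ioo c d) χ)
    (h0 : ∫ x in c..d, χ x = 0) : ∃ φ, IsTestFun (Ioo c d) φ ∧ ∀ x, deriv φ x = χ x := by
  have hcont := hχ.smooth.continuous
  have hd : ∀ x, HasDerivAt (fun x => ∫ t in c..x, χ t) (χ x) x := fun x =>
    intervalIntegral.integral_hasDerivAt_right (hcont.intervalIntegrable _ _)
      (hcont.stronglyMeasurableAtFilter _ _) hcont.continuousAt
  have hderiv : deriv (fun x => ∫ t in c..x, χ t) = χ := funext fun x => (hd x).deriv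
  have hK : IsCompact (tsupport χ) := hχ.compact
  obtain ⟨a, b, hab⟩ : ∃ a b, tsupport χ ⊆ Icc a b ∧ Icc a b ⊆ Ioo c d := by
    rcases (tsupport χ).eq_empty_or_nonempty with he | hne
    -- Reversed endpoints give the empty interval.
    · exact ⟨1, 0, by simp [he], by simp⟩
    · refine ⟨sInf (tsupport χ), sSup (tsupport χ), fun x hx => ⟨csInf_le hK.bddBelow hx,
        le_csSup hK.bddAbove hx⟩, fun x hx => ⟨?_, ?_⟩⟩
      · exact (hχ.supp (hK.sInf_mem hne)).1.trans_le hx.1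
      · exact hx.2.trans_lt (hχ.supp (hK.sSup_mem hne)).2
  have hz : ∀ x, x ∉ Icc a b → χ x = 0 := fun x hx =>
    image_eq_zero_of_notMem_tsupport fun h => hx (hab.1 h)
  -- Left of `a` the integrand vanishes; right of `b` the primitive has already reached the total
  -- integral, which is zero.
  have hzero : ∀ x, x ∉ Icc a b → ∫ t in c..x, χ t = 0 := by
    intro x hx
    by_cases hxa : x < a
    · refine intervalIntegral.integral_zero_ae (Eventually.of_forall fun t ht => ?_)
      by_contra hne
      have ht' : t ∈ Icc a b := by by_contra h; exact hne (hz t h)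
      have := (hab.2 ht').1
      rcases le_total c x with hcx | hcx
      · rw [uIoc_of_le hcx] at ht; linarith [ht.2, ht'.1]
      · rw [uIoc_of_ge hcx] at ht; linarith [ht.2]
    · have hbx : b < x := by
        by_contra h; exact hx ⟨not_lt.1 hxa, not_lt.1 h⟩
      rw [← intervalIntegral.integral_add_adjacent_intervals (hcont.intervalIntegrable c d)
        (hcont.intervalIntegrable d x), h0, zero_add]
      refine intervalIntegral.integral_zero_ae (Eventually.of_forall fun t ht => ?_)
      by_contra hne
      have ht' : t ∈ Icc a b := by by_contra h; exact hne (hz t h)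
      have := (hab.2 ht').2
      rcases le_total d x with hcx | hcx
      · rw [uIoc_of_le hcx] at ht; linarith [ht.1]
      · rw [uIoc_of_ge hcx] at ht; linarith [ht.1, ht'.2]
  have hsub : tsupport (fun x => ∫ t in c..x, χ t) ⊆ Icc a b := by
    refine closure_minimal (fun x hx => ?_) isClosed_Icc
    by_contra h
    exact hx (hzero x h)
  refine ⟨fun x => ∫ t in c..x, χ t, ⟨?_, ?_, hsub.trans hab.2⟩, fun x => (hd x).deriv⟩
  · refine contDiff_infty_iff_deriv.2 ⟨fun x => (hd x).differentiableAt, ?_⟩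
    rw [hderiv]
    exact hχ.smooth
  · exact HasCompactSupport.of_support_subset_isCompact isCompact_Icc
      ((subset_tsupport _).trans hsub)

/-- Subtracting a multiple of such an `η` from a test function makes its integral zero, hence makes
it a derivative of a test function. -/
theorem exists_isTestFun_integral_eq_one {c d : ℝ} (hcd : c < d) :
    ∃ η, IsTestFun (Ioo c d) η ∧ ∫ x in c..d, η x = 1 := by
  let b : ContDiffBump ((c + d) / 2) := ⟨(d - c) / 8, (d - c) / 4, by linarith, by linarith⟩
  have hη : IsTestFun (Ioo c d) (b.normed volume) := by
    refine ⟨b.contDiff_normed, b.hasCompactSupport_normed, ?_⟩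
    rw [b.tsupport_normed_eq, Real.closedBall_eq_Icc]
    intro x hx
    have h1 := hx.1
    have h2 := hx.2
    simp only [b] at h1 h2
    constructor <;> linarith
  refine ⟨_, hη, ?_⟩
  have := hη.setIntegral_mul fun _ => 1
  simp only [one_mul] at this
  rw [← setIntegral_Ioo_eq_intervalIntegral hcd.le, this, b.integral_normed]

/-- A continuous function with an integrable weak derivative is a primitive of it. -/
theorem IsWeakDeriv.sub_eq_integral {c d : ℝ} {f g : ℝ → ℝ} (hf : ContinuousOn f (Ioo c d))
    (hfi : IntegrableOn f (Ioo c d)) (hg : IntegrableOn g (Ioo c d))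
    (h : IsWeakDeriv (Ioo c d) 1 f g) {x y : ℝ} (hx : x ∈ Ioo c d) (hy : y ∈ Ioo c d) :
    f y - f x = ∫ t in x..y, g t := by
  have hcd : c < d := hx.1.trans hx.2
  have hgi : IntervalIntegrable g volume c d :=
    (intervalIntegrable_iff_integrableOn_Ioo_of_le hcd.le).2 hg
  set F : ℝ → ℝ := fun x => ∫ t in c..x, g t with hF
  have hFc : ContinuousOn F (Icc c d) := by
    have := intervalIntegral.continuousOn_primitive_interval' hgi (a := c) (by simp)
    rwa [uIcc_of_le hcd.le] at this
  have hFi : IntegrableOn F (Ioo c d) :=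
    (hFc.integrableOn_compact isCompact_Icc).mono_set Ioo_subset_Icc_self
  obtain ⟨η, hη, hη1⟩ := exists_isTestFun_integral_eq_one hcd
  set r : ℝ → ℝ := fun x => f x - F x with hr
  have hrc : ContinuousOn r (Ioo c d) := hf.sub (hFc.mono Ioo_subset_Icc_self)
  have hri : IntegrableOn r (Ioo c d) := hfi.sub hFi
  -- `f` and the primitive `F` have the same weak derivative, so their difference `r` has weak
  -- derivative zero.
  have horth : ∀ φ, IsTestFun (Ioo c d) φ → ∫ x in Ioo c d, r x * deriv φ x = 0 := by
    intro φ hφ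
    have hc0 : φ c = 0 := image_eq_zero_of_notMem_tsupport fun h => by simpa using hφ.supp h
    have hd0 : φ d = 0 := image_eq_zero_of_notMem_tsupport fun h => by simpa using hφ.supp h
    have h1 := integral_mul_deriv_of_eq_primitive hcd.le hgi (f := F) (fun x _ => by simp [hF])
      (hφ.smooth.of_le (by simp))
    rw [hc0, hd0] at h1
    have h2 := h.byParts φ hφ
    simp only [fderiv_eq_smul_deriv, one_smul] at h2
    have h3 : ∀ x, r x * deriv φ x = f x * deriv φ x - F x * deriv φ x := fun x => by
      simp only [hr]; ring
    simp_rw [h3]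
    rw [integral_sub (hφ.integrableOn_mul_deriv hfi) (hφ.integrableOn_mul_deriv hFi), h2,
      setIntegral_Ioo_eq_intervalIntegral hcd.le, setIntegral_Ioo_eq_intervalIntegral hcd.le, h1]
    ring
  set k := ∫ x in Ioo c d, r x * η x with hk
  -- Du Bois-Reymond: `χ - m η` is the derivative of a test function, so `∫ r χ = m ∫ r η = m k = ∫
  -- k χ`.
  have hae : ∀ᵐ x ∂volume, x ∈ Ioo c d → r x - k = 0 := by
    refine isOpen_Ioo.ae_eq_zero_of_integral_contDiff_smul_eq_zero
      ((hri.sub (integrableOn_const (by simp))).locallyIntegrableOn) fun χ h1 h2 h3 => ?_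
    have hχ : IsTestFun (Ioo c d) χ := ⟨h1, h2, h3⟩
    set m := ∫ x in c..d, χ x with hm
    have hχη : IsTestFun (Ioo c d) fun x => χ x - m * η x := by
      refine ⟨hχ.smooth.sub (contDiff_const.mul hη.smooth),
        hχ.compact.sub hη.compact.mul_left, ?_⟩
      refine (tsupport_sub χ fun x => m * η x).trans (union_subset hχ.supp ?_)
      exact (closure_mono (Function.support_mul_subset_right _ _)).trans hη.supp
    obtain ⟨φ, hφ, hφd⟩ := hχη.exists_deriv_eq (by
      rw [intervalIntegral.integral_sub (hχ.smooth.continuous.intervalIntegrable _ _)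
        ((hη.smooth.continuous.intervalIntegrable _ _).const_mul m),
        intervalIntegral.integral_const_mul, hη1, mul_one, sub_self])
    have h4 := horth φ hφ
    simp_rw [hφd] at h4
    have h5 : ∀ x, r x * (χ x - m * η x) = r x * χ x - m * (r x * η x) := fun x => by ring
    simp_rw [h5] at h4
    rw [integral_sub (hχ.integrableOn_mul hri) ((hη.integrableOn_mul hri).const_mul m),
      integral_const_mul, ← hk] at h4
    have h6 : ∀ x, χ x • (r x - k) = (r x - k) * χ x := fun x => by rw [smul_eq_mul, mul_comm]
    simp_rw [h6]
    rw [← hχ.setIntegral_mul fun x => r x - k]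
    simp_rw [sub_mul]
    rw [integral_sub (hχ.integrableOn_mul hri)
      (hχ.integrableOn_mul (integrableOn_const (by simp))), integral_const_mul,
      setIntegral_Ioo_eq_intervalIntegral hcd.le χ]
    linarith
  have hall : EqOn r (fun _ => k) (Ioo c d) := by
    refine Measure.eqOn_open_of_ae_eq (μ := volume) ?_ isOpen_Ioo hrc continuousOn_const
    rw [EventuallyEq, ae_restrict_iff' measurableSet_Ioo]
    filter_upwards [hae] with x hx hxm using sub_eq_zero.1 (hx hxm)
  have e1 := hall hx
  have e2 := hall hy
  simp only [hr] at e1 e2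
  have hsub : ∀ z ∈ Ioo c d, IntervalIntegrable g volume c z := fun z hz =>
    hgi.mono_set (by
      rw [uIcc_of_le hcd.le, uIcc_of_le hz.1.le]; exact Icc_subset_Icc_right hz.2.le)
  have e3 := intervalIntegral.integral_interval_sub_left (hsub y hy) (hsub x hx)
  simp only [hF] at e1 e2
  linarith

/-- Cutting a function off on an interval at whose endpoints it vanishes also cuts off its weak
derivative. -/
theorem IsWeakDeriv.indicator_compl_Icc {c d a b : ℝ} {f g : ℝ → ℝ}
    (hf : ContinuousOn f (Ioo c d)) (hfi : IntegrableOn f (Ioo c d))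
    (hg : IntegrableOn g (Ioo c d)) (h : IsWeakDeriv (Ioo c d) 1 f g) (hab : a ≤ b)
    (ha : a ∈ Ioo c d) (hb : b ∈ Ioo c d) (hfa : f a = 0) (hfb : f b = 0) :
    IsWeakDeriv (Ioo c d) 1 ((Icc a b)ᶜ.indicator f) ((Icc a b)ᶜ.indicator g) where
  locInt := (hfi.indicator measurableSet_Icc.compl).locallyIntegrableOn
  locInt' := (hg.indicator measurableSet_Icc.compl).locallyIntegrableOn
  byParts φ hφ := by
    have hsub : Icc a b ⊆ Ioo c d := fun x hx => ⟨ha.1.trans_le hx.1, hx.2.trans_lt hb.2⟩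
    have hgi : IntervalIntegrable g volume a b :=
      (intervalIntegrable_iff_integrableOn_Icc_of_le hab).2 (hg.mono_set hsub)
    -- Since `f` vanishes at `a` and `b`, integration by parts holds on `[a, b]` without boundary
    -- terms; subtracting it from the identity on `(c, d)` leaves the claim.
    have h1 := integral_mul_deriv_of_eq_primitive hab hgi (f := f) (fun x hx => by
      rw [← h.sub_eq_integral hf hfi hg ha (hsub hx)]; ring) (hφ.smooth.of_le (by simp))
    rw [hfa, hfb, intervalIntegral.integral_of_le hab, intervalIntegral.integral_of_le hab,
      ← integral_Icc_eq_integral_Ioc, ← integral_Icc_eq_integral_Ioc] at h1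
    have h2 := h.byParts φ hφ
    simp only [fderiv_eq_smul_deriv, one_smul] at h2 ⊢
    have key : ∀ F ψ : ℝ → ℝ, IntegrableOn (fun x => F x * ψ x) (Ioo c d) →
        ∫ x in Ioo c d, (Icc a b)ᶜ.indicator F x * ψ x =
          (∫ x in Ioo c d, F x * ψ x) - ∫ x in Icc a b, F x * ψ x := by
      intro F ψ hF
      have e : ∀ x, (Icc a b)ᶜ.indicator F x * ψ x =
          (Icc a b)ᶜ.indicator (fun x => F x * ψ x) x := fun x => by
        by_cases hx : x ∈ (Icc a b)ᶜ
        · rw [indicator_of_mem hx, indicator_of_mem hx]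
        · rw [indicator_of_notMem hx, indicator_of_notMem hx, zero_mul]
      simp_rw [e]
      rw [setIntegral_indicator measurableSet_Icc.compl, ← sdiff_eq,
        setIntegral_sdiff measurableSet_Icc hF hsub]
    rw [key f _ (hφ.integrableOn_mul_deriv hfi), key g _ (hφ.integrableOn_mul hg), h1, h2]
    ring

/-! ### The space `H²_D` and flattening between critical points -/

namespace MemH2D

variable {L : ℝ} {u : ℝ → ℝ}

theorem hasDerivAt (hu : MemH2D L u) {x : ℝ} (hx : x ∈ Ioo (-L) L) :
    HasDerivAt u (deriv u x) x :=
  ((hu.contDiffOn.differentiableOn (by simp)).differentiableAt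
    (Icc_mem_nhds hx.1 hx.2)).hasDerivAt

theorem continuousOn_deriv (hu : MemH2D L u) : ContinuousOn (deriv u) (Ioo (-L) L) :=
  (hu.contDiffOn.mono Ioo_subset_Icc_self).continuousOn_deriv_of_isOpen isOpen_Ioo (by simp)

theorem isWeakDeriv_secondDeriv (hu : MemH2D L u) :
    IsWeakDeriv (Ioo (-L) L) 1 (deriv u) (secondDeriv L u) := by
  obtain ⟨g, hg, -⟩ := hu.memH1_deriv.weak 1
  exact isWeakDeriv_weakDeriv hg

/-- `MemH1` provides some weak derivative in `L₂`; uniqueness a.e. transfers this to the chosen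
representative. -/
theorem memLp_secondDeriv (hu : MemH2D L u) :
    MemLp (secondDeriv L u) 2 (volume.restrict (Ioo (-L) L)) := by
  obtain ⟨g, hg, hg2⟩ := hu.memH1_deriv.weak 1
  exact hg2.ae_eq (hg.ae_eq isOpen_Ioo hu.isWeakDeriv_secondDeriv)

theorem integrableOn_secondDeriv (hu : MemH2D L u) :
    IntegrableOn (secondDeriv L u) (Ioo (-L) L) :=
  hu.memLp_secondDeriv.integrable (by norm_num)

theorem integrableOn_deriv (hu : MemH2D L u) : IntegrableOn (deriv u) (Ioo (-L) L) :=
  hu.memH1_deriv.memL2.integrable (by norm_num)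

end MemH2D

open Classical in
/-- The function `u`, replaced by the constant `c` on `[a, b]`. -/
noncomputable def flatten (a b c : ℝ) (u : ℝ → ℝ) : ℝ → ℝ := (Icc a b).piecewise (fun _ => c) u

theorem flatten_of_mem {a b c : ℝ} {u : ℝ → ℝ} {x : ℝ} (hx : x ∈ Icc a b) :
    flatten a b c u x = c := piecewise_eq_of_mem _ _ _ hx

theorem flatten_of_notMem {a b c : ℝ} {u : ℝ → ℝ} {x : ℝ} (hx : x ∉ Icc a b) :
    flatten a b c u x = u x := piecewise_eq_of_notMem _ _ _ hx

theorem abs_flatten_sub_le (a b c : ℝ) (u : ℝ → ℝ) (x : ℝ) :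
    |flatten a b c u x - c| ≤ |u x - c| := by
  by_cases hx : x ∈ Icc a b
  · simp [flatten_of_mem hx]
  · simp [flatten_of_notMem hx]

/-- At an endpoint, flattening only decreases `|u - c|`, so `u - c = o(y - x)` is inherited.
Elsewhere the function is locally `c` or locally `u`. Working within `s` covers the one-sided
derivatives at `±L`. -/
theorem hasDerivWithinAt_flatten {a b c x u' : ℝ} {u : ℝ → ℝ} {s : Set ℝ}
    (hu : HasDerivWithinAt u u' s x) (hab : a ≤ b) (ha : u a = c) (hb : u b = c)
    (hcrit : x = a ∨ x = b → u' = 0) :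
    HasDerivWithinAt (flatten a b c u) ((Icc a b)ᶜ.indicator (fun _ => u') x) s x := by
  by_cases hx : x ∈ Icc a b
  · rw [indicator_of_notMem (by simpa using hx)]
    by_cases hend : x = a ∨ x = b
    · have hux : u x = c := by rcases hend with rfl | rfl <;> assumption
      rw [hcrit hend] at hu
      rw [hasDerivWithinAt_iff_isLittleO] at hu ⊢
      refine Asymptotics.IsBigO.trans_isLittleO ?_ hu
      refine Asymptotics.isBigO_of_le _ fun y => ?_
      simpa [flatten_of_mem hx, hux] using abs_flatten_sub_le a b c u y
    · have hx' : x ∈ Ioo a b :=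
        ⟨lt_of_le_of_ne hx.1 fun h => hend (Or.inl h.symm),
          lt_of_le_of_ne hx.2 fun h => hend (Or.inr h)⟩
      refine HasDerivAt.hasDerivWithinAt ((hasDerivAt_const x c).congr_of_eventuallyEq ?_)
      filter_upwards [Icc_mem_nhds hx'.1 hx'.2] with y hy using flatten_of_mem hy
  · rw [indicator_of_mem (by simpa using hx)]
    refine hu.congr_of_eventuallyEq ?_ (flatten_of_notMem hx)
    filter_upwards [mem_nhdsWithin_of_mem_nhds (isClosed_Icc.isOpen_compl.mem_nhds hx)]
      with y hy using flatten_of_notMem hy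

/-- At zeros of `f`, the endpoints included, the cut-off is squeezed by `|f|`; elsewhere it is
locally `0` or locally `f`. -/
theorem ContinuousOn.indicator_compl_Icc {a b : ℝ} {f : ℝ → ℝ} {s : Set ℝ}
    (hf : ContinuousOn f s) (ha : f a = 0) (hb : f b = 0) :
    ContinuousOn ((Icc a b)ᶜ.indicator f) s := by
  intro x hx
  by_cases hxa : f x = 0
  · have h0 : (Icc a b)ᶜ.indicator f x = 0 := by
      by_cases h : x ∈ (Icc a b)ᶜ
      · rw [indicator_of_mem h, hxa]
      · rw [indicator_of_notMem h]
    have h1 := hf x hx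
    rw [ContinuousWithinAt, hxa] at h1
    rw [ContinuousWithinAt, h0]
    exact squeeze_zero_norm (fun y => norm_indicator_le_norm_self f y) (by simpa using h1.norm)
  · have hne : x ≠ a ∧ x ≠ b := ⟨fun h => hxa (h ▸ ha), fun h => hxa (h ▸ hb)⟩
    by_cases h : x ∈ Icc a b
    · have h' : Icc a b ∈ 𝓝 x :=
        Icc_mem_nhds (lt_of_le_of_ne h.1 hne.1.symm) (lt_of_le_of_ne h.2 hne.2)
      refine ContinuousAt.continuousWithinAt
        (continuousAt_const.congr (f := fun _ => (0 : ℝ)) ?_)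
      filter_upwards [h'] with y hy
      rw [indicator_of_notMem (by simpa using hy)]
    · refine (hf x hx).congr_of_eventuallyEq ?_ (indicator_of_mem (by simpa using h) _)
      filter_upwards [mem_nhdsWithin_of_mem_nhds (isClosed_Icc.isOpen_compl.mem_nhds h)]
        with y hy using indicator_of_mem hy _

namespace MemH2D

variable {L a b c : ℝ} {u : ℝ → ℝ}

theorem deriv_flatten (hu : MemH2D L u) (hab : a ≤ b) (hua : u a = c) (hub : u b = c)
    (ha' : deriv u a = 0) (hb' : deriv u b = 0) {x : ℝ} (hx : x ∈ Ioo (-L) L) :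
    deriv (flatten a b c u) x = (Icc a b)ᶜ.indicator (deriv u) x := by
  have := hasDerivWithinAt_flatten (hu.hasDerivAt hx).hasDerivWithinAt (s := univ) hab hua hub
    (by rintro (rfl | rfl) <;> assumption)
  rw [hasDerivWithinAt_univ] at this
  rw [this.deriv]
  rfl

theorem isWeakDeriv_deriv_flatten (hu : MemH2D L u) (hab : a ≤ b) (ha : a ∈ Ioo (-L) L)
    (hb : b ∈ Ioo (-L) L) (hua : u a = c) (hub : u b = c)
    (ha' : deriv u a = 0) (hb' : deriv u b = 0) :
    IsWeakDeriv (Ioo (-L) L) 1 (deriv (flatten a b c u))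
      ((Icc a b)ᶜ.indicator (secondDeriv L u)) := by
  have h := hu.isWeakDeriv_secondDeriv.indicator_compl_Icc hu.continuousOn_deriv
    hu.integrableOn_deriv hu.integrableOn_secondDeriv hab ha hb ha' hb'
  have heq : EqOn (deriv (flatten a b c u)) ((Icc a b)ᶜ.indicator (deriv u)) (Ioo (-L) L) :=
    fun x hx => hu.deriv_flatten hab hua hub ha' hb' hx
  refine ⟨?_, h.locInt', fun φ hφ => ?_⟩
  · refine IntegrableOn.locallyIntegrableOn ?_
    exact (integrableOn_congr_fun heq measurableSet_Ioo).2
      (hu.integrableOn_deriv.indicator measurableSet_Icc.compl)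
  · rw [← h.byParts φ hφ]
    exact setIntegral_congr_fun measurableSet_Ioo fun x hx => by simp only [heq hx]

/-- Replacing `u` by a constant between two critical points of the same height does not lead out
of `H²_D`. -/
theorem flatten (hu : MemH2D L u) (hab : a ≤ b) (ha : a ∈ Ioo (-L) L)
    (hb : b ∈ Ioo (-L) L) (hua : u a = c) (hub : u b = c)
    (ha' : deriv u a = 0) (hb' : deriv u b = 0) : MemH2D L (flatten a b c u) := by
  have hL : -L < L := ha.1.trans ha.2
  have hdw : ∀ x ∈ Ioo (-L) L, derivWithin u (Icc (-L) L) x = deriv u x := fun x hx =>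
    derivWithin_of_mem_nhds (Icc_mem_nhds hx.1 hx.2)
  have hd : ∀ x ∈ Icc (-L) L, HasDerivWithinAt (_root_.flatten a b c u)
      ((Icc a b)ᶜ.indicator (derivWithin u (Icc (-L) L)) x) (Icc (-L) L) x := fun x hx =>
    hasDerivWithinAt_flatten
      ((hu.contDiffOn.differentiableOn (by simp)) x hx).hasDerivWithinAt hab hua hub (by
        rintro (rfl | rfl)
        · rw [hdw _ ha, ha']
        · rw [hdw _ hb, hb'])
  have huniq : UniqueDiffOn ℝ (Icc (-L) L) := uniqueDiffOn_Icc hL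
  have hdeq : EqOn (derivWithin (_root_.flatten a b c u) (Icc (-L) L))
      ((Icc a b)ᶜ.indicator (derivWithin u (Icc (-L) L))) (Icc (-L) L) := fun x hx =>
    (hd x hx).derivWithin (huniq x hx)
  have hleft : -L ∉ Icc a b := fun h => absurd ha.1 (not_lt.2 h.1)
  have hright : L ∉ Icc a b := fun h => absurd hb.2 (not_lt.2 h.2)
  constructor
  · rw [contDiffOn_one_iff_derivWithin huniq]
    refine ⟨fun x hx => (hd x hx).differentiableWithinAt, ?_⟩
    refine ContinuousOn.congr ?_ hdeq
    exact (hu.contDiffOn.continuousOn_derivWithin huniq (by simp)).indicator_compl_Icc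
      (by rw [hdw _ ha, ha']) (by rw [hdw _ hb, hb'])
  · have hw := hu.isWeakDeriv_deriv_flatten hab ha hb hua hub ha' hb'
    refine ⟨?_, fun v => ⟨_, hw.direction v, ?_⟩⟩
    · refine (hu.memH1_deriv.memL2.indicator measurableSet_Icc.compl).ae_eq
        (ae_restrict_of_forall_mem measurableSet_Ioo fun x hx =>
        (hu.deriv_flatten hab hua hub ha' hb' hx).symm)
    · exact (hu.memLp_secondDeriv.indicator measurableSet_Icc.compl).const_mul v
  · rw [flatten_of_notMem hleft, hu.left]
  · rw [flatten_of_notMem hright, hu.right]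
  · rw [hdeq (left_mem_Icc.2 hL.le), indicator_of_mem (by simpa using hleft), hu.deriv_left]
  · rw [hdeq (right_mem_Icc.2 hL.le), indicator_of_mem (by simpa using hright), hu.deriv_right]

theorem secondDeriv_flatten (hu : MemH2D L u) (hab : a ≤ b) (ha : a ∈ Ioo (-L) L)
    (hb : b ∈ Ioo (-L) L) (hua : u a = c) (hub : u b = c)
    (ha' : deriv u a = 0) (hb' : deriv u b = 0) :
    secondDeriv L (_root_.flatten a b c u) =ᵐ[volume.restrict (Ioo (-L) L)]
      (Icc a b)ᶜ.indicator (secondDeriv L u) :=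
  (hu.flatten hab ha hb hua hub ha' hb').isWeakDeriv_secondDeriv.ae_eq isOpen_Ioo
    (hu.isWeakDeriv_deriv_flatten hab ha hb hua hub ha' hb')

end MemH2D

/-- A function in `H²_D` whose second derivative vanishes almost everywhere between two critical
points is constant there. -/
theorem MemH2D.eq_of_secondDeriv_eq_zero {L a b : ℝ} {u : ℝ → ℝ} (hu : MemH2D L u)
    (ha : a ∈ Ioo (-L) L) (hb : b ∈ Ioo (-L) L) (ha' : deriv u a = 0)
    (h : ∀ᵐ x, x ∈ Icc a b → secondDeriv L u x = 0) {x : ℝ} (hx : x ∈ Icc a b) :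
    u x = u a := by
  have hsub : Icc a b ⊆ Ioo (-L) L := fun x hx => ⟨ha.1.trans_le hx.1, hx.2.trans_lt hb.2⟩
  have hz : ∀ y ∈ Icc a b, deriv u y = 0 := fun y hy => by
    have e := hu.isWeakDeriv_secondDeriv.sub_eq_integral hu.continuousOn_deriv
      hu.integrableOn_deriv hu.integrableOn_secondDeriv ha (hsub hy)
    rw [ha', sub_zero] at e
    rw [e]
    refine intervalIntegral.integral_zero_ae ?_
    filter_upwards [h] with t ht htm
    rw [uIoc_of_le hy.1] at htm
    exact ht ⟨htm.1.le, htm.2.trans hy.2⟩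
  refine constant_of_has_deriv_right_zero
    (fun y hy => (hu.hasDerivAt (hsub hy)).continuousAt.continuousWithinAt)
    (fun y hy => ?_) x hx
  have hy' : y ∈ Icc a b := Ico_subset_Icc_self hy
  have := (hu.hasDerivAt (hsub hy')).hasDerivWithinAt (s := Ici y)
  rwa [hz y hy'] at this

/-! ### The sign of the electrostatic force -/

/-- If `f` is constant along a one-sided curve in `s` issuing from `p`, then its derivative at `p`
vanishes in the direction of the curve. -/
theorem fderivWithin_apply_eq_zero_of_curve {E : Type*} [NormedAddCommGroup E] [NormedSpace ℝ E]
    {f : E → ℝ} {s : Set E} {p v : E} {t₀ k : ℝ} {γ : ℝ → E} {T : Set ℝ}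
    (hf : DifferentiableWithinAt ℝ f s p) (hT : UniqueDiffWithinAt ℝ T t₀) (ht₀ : t₀ ∈ T)
    (hγ : HasDerivWithinAt γ v T t₀) (hp : γ t₀ = p) (hmaps : MapsTo γ T s)
    (hconst : ∀ t ∈ T, f (γ t) = k) : fderivWithin ℝ f s p v = 0 := by
  subst hp
  have h1 := hf.hasFDerivWithinAt.comp_hasDerivWithinAt t₀ hγ hmaps
  have h2 : HasDerivWithinAt (f ∘ γ) 0 T t₀ :=
    (hasDerivWithinAt_const t₀ T k).congr hconst (hconst t₀ ht₀)
  exact hT.eq_deriv _ h1 h2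

namespace Device.Admissible

variable {P : Device} {V : ℝ}

theorem dxh₂_eq_zero (hP : P.Admissible)
    (helastic : ∀ x ∈ Icc (-P.L) P.L, ∀ w : ℝ, -P.H ≤ w → P.h₂ (x, w, w) = V)
    {x w : ℝ} (hx : x ∈ P.D) (hw : -P.H ≤ w) : P.dxh₂ (x, w, w) = 0 := by
  have hx' : x ∈ Icc (-P.L) P.L := Ioo_subset_Icc_self hx
  have hlt : -P.L < P.L := by linarith [hP.L_pos]
  refine fderivWithin_apply_eq_zero_of_curve (γ := fun t => (t, w, w)) (T := Icc (-P.L) P.L)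
    (hP.h₂_smooth.differentiableOn (by simp) _ ⟨hx', hw, hw⟩) (uniqueDiffOn_Icc hlt x hx') hx'
    ?_ rfl (fun t ht => ⟨ht, hw, hw⟩) (fun t ht => helastic t ht w hw)
  exact (hasDerivWithinAt_id x _).prodMk (hasDerivWithinAt_const x _ (w, w))

/-- The direction `(0, 1, 1)` is tangent to the diagonal, along which `h₂` is constant. The
half-line of parameters includes `w = -H`, where only a one-sided derivative exists. -/
theorem dzh₂_add_dwh₂_eq_zero (hP : P.Admissible)
    (helastic : ∀ x ∈ Icc (-P.L) P.L, ∀ w : ℝ, -P.H ≤ w → P.h₂ (x, w, w) = V)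
    {x w : ℝ} (hx : x ∈ P.D) (hw : -P.H ≤ w) :
    P.dzh₂ (x, w, w) + P.dwh₂ (x, w, w) = 0 := by
  have hx' : x ∈ Icc (-P.L) P.L := Ioo_subset_Icc_self hx
  have h : fderivWithin ℝ P.h₂ P.dom₂ (x, w, w) (0, 1, 1) = 0 := by
    refine fderivWithin_apply_eq_zero_of_curve (γ := fun t => (x, t, t)) (T := Ici (-P.H))
      (hP.h₂_smooth.differentiableOn (by simp) _ ⟨hx', hw, hw⟩)
      (uniqueDiffOn_Ici _ w hw) hw ?_ rfl (fun t ht => ⟨hx', ht, ht⟩)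
      (fun t ht => helastic x hx' t ht)
    exact (hasDerivWithinAt_const w _ x).prodMk
      ((hasDerivWithinAt_id w _).prodMk (hasDerivWithinAt_id w _))
  rw [dzh₂, dwh₂, ← map_add]
  simpa using h

theorem dwh₁_eq_zero (hP : P.Admissible)
    (hground : ∀ x ∈ Icc (-P.L) P.L, ∀ w : ℝ, -P.H ≤ w → P.h₁ (x, -P.H - P.d, w) = 0)
    {x w : ℝ} (hx : x ∈ P.D) (hw : -P.H ≤ w) : P.dwh₁ (x, -P.H - P.d, w) = 0 := by
  have hx' : x ∈ Icc (-P.L) P.L := Ioo_subset_Icc_self hx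
  have hz : -P.H - P.d ∈ Icc (-P.H - P.d) (-P.H) := ⟨le_rfl, by linarith [hP.d_pos]⟩
  refine fderivWithin_apply_eq_zero_of_curve (γ := fun t => (x, -P.H - P.d, t))
    (T := Ici (-P.H)) (hP.h₁_smooth.differentiableOn (by simp) _ ⟨hx', hz, hw⟩)
    (uniqueDiffOn_Ici _ w hw) hw ?_ rfl (fun t ht => ⟨hx', hz, ht⟩)
    (fun t ht => hground x hx' t ht)
  exact (hasDerivWithinAt_const w _ x).prodMk
    ((hasDerivWithinAt_const w _ (-P.H - P.d)).prodMk (hasDerivWithinAt_id w _))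

/-- Between plates at constant potentials the electrostatic force is non-negative. -/
theorem force_nonneg (hP : P.Admissible)
    (hground : ∀ x ∈ Icc (-P.L) P.L, ∀ w : ℝ, -P.H ≤ w → P.h₁ (x, -P.H - P.d, w) = 0)
    (helastic : ∀ x ∈ Icc (-P.L) P.L, ∀ w : ℝ, -P.H ≤ w → P.h₂ (x, w, w) = V)
    {u : ℝ → ℝ} (ψ : ℝ × ℝ → ℝ) {x : ℝ} (hx : x ∈ P.D) (hux : -P.H ≤ u x) :
    0 ≤ P.force u ψ x := by
  have hmain : 0 ≤ P.forceMain u ψ x := by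
    have := hP.σ₂_pos
    unfold forceMain
    split_ifs <;> positivity
  rw [force, hP.dxh₂_eq_zero helastic hx hux, hP.dzh₂_add_dwh₂_eq_zero helastic hx hux,
    hP.dwh₁_eq_zero hground hx hux]
  simpa using hmain

end Device.Admissible

/-! ### The flattened competitor in the variational inequality -/

namespace Device

variable {P : Device} {u : ℝ → ℝ}

theorem S₀.deriv_eq_zero (hu : u ∈ P.S₀) {a : ℝ} (ha : a ∈ P.coincidenceSet u) :
    deriv u a = 0 := by
  refine IsLocalMin.deriv_eq_zero ?_
  filter_upwards [isOpen_Ioo.mem_nhds ha.1] with y hy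
  rw [ha.2]
  exact hu.2 y hy

theorem flatten_mem_S₀ (hu : u ∈ P.S₀) {a b : ℝ} (hab : a ≤ b) (ha : a ∈ P.coincidenceSet u)
    (hb : b ∈ P.coincidenceSet u) : flatten a b (-P.H) u ∈ P.S₀ := by
  refine ⟨hu.1.flatten hab ha.1 hb.1 ha.2 hb.2 (S₀.deriv_eq_zero hu ha)
    (S₀.deriv_eq_zero hu hb), fun x hx => ?_⟩
  by_cases h : x ∈ Icc a b
  · rw [flatten_of_mem h]
  · rw [flatten_of_notMem h]
    exact hu.2 x hx

/-- If the force is non-negative, a solution of the obstacle problem has no curvature between two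
points of the coincidence set. -/
theorem secondDeriv_eq_zero_of_force_nonneg (hP : P.Admissible) {ψ : ℝ × ℝ → ℝ}
    (hu : u ∈ P.S₀) (hforce : ∀ x ∈ P.D, 0 ≤ P.force u ψ x)
    (hineq : ∀ w ∈ P.S₀, - ∫ x in P.D, P.force u ψ x * (w x - u x) ≤
      ∫ x in P.D, (P.β * secondDeriv P.L u x * (secondDeriv P.L w x - secondDeriv P.L u x)
        + (P.τ + P.α * ∫ y in P.D, (deriv u y) ^ 2) * deriv u x * (deriv w x - deriv u x)))
    {a b : ℝ} (hab : a ≤ b) (ha : a ∈ P.coincidenceSet u) (hb : b ∈ P.coincidenceSet u) :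
    ∀ᵐ x, x ∈ Icc a b → secondDeriv P.L u x = 0 := by
  have hsub : Icc a b ⊆ P.D := fun x hx => ⟨ha.1.1.trans_le hx.1, hx.2.trans_lt hb.1.2⟩
  have ha' := S₀.deriv_eq_zero hu ha
  have hb' := S₀.deriv_eq_zero hu hb
  set T := P.τ + P.α * ∫ y in P.D, (deriv u y) ^ 2 with hT
  have hT0 : 0 ≤ T :=
    add_nonneg hP.τ_nonneg (mul_nonneg hP.α_nonneg (integral_nonneg fun y => sq_nonneg _))
  set q : ℝ → ℝ := fun x => P.β * secondDeriv P.L u x ^ 2 + T * deriv u x ^ 2 with hq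
  have hq0 : ∀ x, 0 ≤ q x := fun x =>
    add_nonneg (mul_nonneg hP.β_pos.le (sq_nonneg _)) (mul_nonneg hT0 (sq_nonneg _))
  have hqi : IntegrableOn q (Icc a b) :=
    IntegrableOn.mono_set ((hu.1.memLp_secondDeriv.integrable_sq.const_mul P.β).add
      (hu.1.memH1_deriv.memL2.integrable_sq.const_mul T)) hsub
  have hw := hineq _ (flatten_mem_S₀ hu hab ha hb)
  -- The pointwise sign suffices: if the integrand is not integrable, its integral is `0` by
  -- convention and the bound persists.
  have hleft : 0 ≤ - ∫ x in P.D, P.force u ψ x * (flatten a b (-P.H) u x - u x) := by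
    refine neg_nonneg.2 (setIntegral_nonpos measurableSet_Ioo fun x hx => ?_)
    refine mul_nonpos_of_nonneg_of_nonpos (hforce x hx) ?_
    by_cases h : x ∈ Icc a b
    · rw [flatten_of_mem h]
      exact sub_nonpos.2 (hu.2 x hx)
    · rw [flatten_of_notMem h, sub_self]
  have hright : ∫ x in P.D, (P.β * secondDeriv P.L u x *
        (secondDeriv P.L (flatten a b (-P.H) u) x - secondDeriv P.L u x)
        + T * deriv u x * (deriv (flatten a b (-P.H) u) x - deriv u x)) =
      - ∫ x in Icc a b, q x := by
    have hae : (fun x => P.β * secondDeriv P.L u x *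
        (secondDeriv P.L (flatten a b (-P.H) u) x - secondDeriv P.L u x)
        + T * deriv u x * (deriv (flatten a b (-P.H) u) x - deriv u x))
        =ᵐ[volume.restrict P.D] fun x => - (Icc a b).indicator q x := by
      filter_upwards [hu.1.secondDeriv_flatten hab ha.1 hb.1 ha.2 hb.2 ha' hb',
        ae_restrict_mem measurableSet_Ioo] with x hx hxD
      rw [hx, hu.1.deriv_flatten hab ha.2 hb.2 ha' hb' hxD]
      by_cases h : x ∈ Icc a b
      · rw [indicator_of_notMem (by simpa using h), indicator_of_notMem (by simpa using h),
          indicator_of_mem h]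
        simp only [hq]
        ring
      · rw [indicator_of_mem (by simpa using h), indicator_of_mem (by simpa using h),
          indicator_of_notMem h]
        ring
    rw [integral_congr_ae hae, integral_neg, setIntegral_indicator measurableSet_Icc,
      inter_eq_right.2 hsub]
  rw [hright] at hw
  have hzero : ∫ x in Icc a b, q x = 0 :=
    le_antisymm (by linarith) (integral_nonneg hq0)
  have hqz := (integral_eq_zero_iff_of_nonneg hq0 hqi).1 hzero
  rw [EventuallyEq, ae_restrict_iff' measurableSet_Icc] at hqz
  filter_upwards [hqz] with x hx hxm
  have h0 : P.β * secondDeriv P.L u x ^ 2 + T * deriv u x ^ 2 = 0 := hx hxm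
  -- Only the bending term is used: `T` may vanish, whereas `β > 0`.
  have h1 : P.β * secondDeriv P.L u x ^ 2 = 0 := by
    have := mul_nonneg hP.β_pos.le (sq_nonneg (secondDeriv P.L u x))
    have := mul_nonneg hT0 (sq_nonneg (deriv u x))
    linarith
  simpa [hP.β_pos.ne'] using h1

end Device

theorem corollary1 (P : Device) (hP : P.Admissible) (V : ℝ) (hV : 0 < V)
    (hground : ∀ x ∈ Set.Icc (-P.L) P.L, ∀ w : ℝ, -P.H ≤ w → P.h₁ (x, -P.H - P.d, w) = 0)
    (helastic : ∀ x ∈ Set.Icc (-P.L) P.L, ∀ w : ℝ, -P.H ≤ w → P.h₂ (x, w, w) = V)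
    (u : ℝ → ℝ) (hu : P.IsWeakSolution u) :
    P.coincidenceSet u = ∅ ∨
      ((P.coincidenceSet u).Nonempty ∧ (P.coincidenceSet u).OrdConnected) := by
  refine (P.coincidenceSet u).eq_empty_or_nonempty.imp_right fun hne => ⟨hne, ⟨?_⟩⟩
  intro a ha b hb x hx
  obtain ⟨huS, ψ, -, hineq⟩ := hu
  have hab : a ≤ b := hx.1.trans hx.2
  have hz := Device.secondDeriv_eq_zero_of_force_nonneg hP huS
    (fun x hx => hP.force_nonneg hground helastic ψ hx (huS.2 x hx)) hineq hab ha hb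
  have hux := huS.1.eq_of_secondDeriv_eq_zero ha.1 hb.1 (Device.S₀.deriv_eq_zero huS ha) hz hx
  exact ⟨⟨ha.1.1.trans_le hx.1, hx.2.trans_lt hb.1.2⟩, hux.trans ha.2⟩
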